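/- Let $\mathcal P$ be a finite-dimensional Hausdorff $C^\infty$ manifold, $\eta$ a smooth $3$-vector field and $\theta$ a smooth one-form on $\mathcal P$. For a $(k+1)$-vector field $X$ and a one-form $\alpha$ let $\iota_\alpha X$ be the right contraction $(\iota_\alpha X)(\beta_1,\dots,\beta_k)=X(\beta_1,\dots,\beta_k,\alpha)$, let $\iota_{\alpha\wedge\beta}X=\iota_\alpha\iota_\beta X$, and for $F\in C^\infty(\mathcal P)$ let $d_\theta F=dF-F\theta$. A smooth bivector field $\Lambda$ on an open set $U$ is Poisson if $\{F_1,F_2\}=\Lambda(dF_1,dF_2)$ satisfies the Jacobi identity on $C^\infty(U)$. A smooth $3$-vector field $\eta$ on $U$ is Nambu–Poisson if $\{F_1,F_2,F_3\}=\eta(dF_1,dF_2,dF_3)$ satisfies the fundamental identity $$\{\{F_1,F_2,F_3\},F_4,F_5\}+\{F_3,\{F_1,F_2,F_4\},F_5\}+\{F_3,F_4,\{F_1,F_2,F_5\}\}=\{F_1,F_2,\{F_3,F_4,F_5\}\}$$ on $C^\infty(U)$. A pair $(\Lambda,Z)$ of a bivector field and a vector field on $\mathcal P$ is a *locally conformal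 Poisson structure with Lee form $\theta$* if there are an open cover $(U_a)$ of $\mathcal P$, smooth functions $\sigma_a:U_a\to\mathbb R$ and Poisson bivector fields $\Lambda_a$ on $U_a$ with $d\sigma_a=d\sigma_b$ and $e^{-\sigma_a}\Lambda_a=e^{-\sigma_b}\Lambda_b$ on $U_a\cap U_b$, such that $\theta=d\sigma_a$ and $\Lambda=e^{-\sigma_a}\Lambda_a$ on every $U_a$, and $Z=\iota_\theta\Lambda$. A pair $(\eta,\mathcal E)$ of a $3$-vector field and a bivector field on $\mathcal P$ (equivalently the triple $(\mathcal P,\eta,\mathcal E)$) is a *locally conformal $3$-Nambu–Poisson structure with Lee form $\theta$* if there are an open cover $(U_a)$ of $\mathcal P$, smooth functions $\sigma_a:U_a\to\mathbb R$ and Nambu–Poisson $3$-vector fields $\eta_a$ on $U_a$ with $d\sigma_a=d\sigma_b$ and $e^{-2\sigma_a}\eta_a=e^{-2\sigma_b}\eta_b$ on $U_a\cap U_b$, such that $\theta=d\sigma_a$ and $\eta=e^{-2\sigma_a}\eta_a$ on every $U_a$, and $\mathcal E=-\iota_\theta\eta$. (Each of the two definitions forces $\theta$ to be closed.) Then the triple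 $(\mathcal P,\eta,-\iota_\theta\eta)$ is a locally conformal $3$-Nambu–Poisson structure with Lee form $\theta$ if and only if, for every $F\in C^\infty(\mathcal P)$, the pair $$(\Lambda,Z)=\bigl(\iota_{d_\theta F}\eta,\;-\iota_{d_\theta F\wedge\theta}\eta\bigr)$$ is a locally conformal Poisson structure with Lee form $\theta$. -/

import Mathlib

open Set Manifold
open scoped ContDiff Topology

noncomputable section

namespace LocallyConformal

universe u v

variable {E : Type v} [NormedAddCommGroup E] [NormedSpace ℝ E]

/-- The cotangent space `T*ₓM`. -/
abbrev Cotangent (E : Type v) [NormedAddCommGroup E] [NormedSpace ℝ E]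
    {M : Type u} [TopologicalSpace M] [ChartedSpace E M] (x : M) : Type v :=
  TangentSpace 𝓘(ℝ, E) x →L[ℝ] ℝ

/-- A (rough) field of `k`-vectors on `M`: at every point `x`, an alternating `k`-linear form on the
cotangent space, that is, an element of `Λᵏ TₓM` (the manifolds below are finite dimensional).
A field on an open set `U` is such a family of which only the values on `U` are used. -/
abbrev MultivectorField (E : Type v) [NormedAddCommGroup E] [NormedSpace ℝ E]
    (M : Type u) [TopologicalSpace M] [ChartedSpace E M] (k : ℕ) : Type (max u v) :=
  (x : M) → (Cotangent E x) [⋀^Fin k]→ₗ[ℝ] ℝ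

/-- Smooth one-forms on `M`: smooth sections of the cotangent bundle. -/
abbrev SmoothOneForm (E : Type v) [NormedAddCommGroup E] [NormedSpace ℝ E]
    (M : Type u) [TopologicalSpace M] [ChartedSpace E M] [IsManifold 𝓘(ℝ, E) ∞ M] :
    Type (max u v) :=
  Cₛ^∞⟮𝓘(ℝ, E); E →L[ℝ] ℝ,
    fun x : M => TangentSpace 𝓘(ℝ, E) x →L[ℝ] Bundle.Trivial M ℝ x⟯

section

variable {M : Type u} [TopologicalSpace M] [ChartedSpace E M]

/-- The differential `df` at `x`, as a cotangent vector. -/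
def differential (f : M → ℝ) (x : M) : Cotangent E x :=
  mvfderiv 𝓘(ℝ, E) f x

/-- The Lichnerowicz–de Rham differential of a function, `d_θ f = df - f θ`, at `x`. -/
def ldrDifferential (θ : (x : M) → Cotangent E x) (f : M → ℝ) (x : M) : Cotangent E x :=
  differential f x - f x • θ x

/-- Smoothness of a real function on `U`. -/
abbrev SmoothOn (E : Type v) [NormedAddCommGroup E] [NormedSpace ℝ E]
    {M : Type u} [TopologicalSpace M] [ChartedSpace E M] (U : Set M) (f : M → ℝ) : Prop :=
  ContMDiffOn 𝓘(ℝ, E) 𝓘(ℝ, ℝ) ∞ f U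

/-- The `k`-bracket of functions `{F₁,…,F_k} = X(dF₁,…,dF_k)` of a field of `k`-vectors. -/
def bracket {k : ℕ} (X : MultivectorField E M k) (F : Fin k → M → ℝ) (x : M) : ℝ :=
  X x (fun i => differential (F i) x)

/-- Smoothness of a field of `k`-vectors on the open set `U`: its bracket sends smooth functions
on `U` to smooth functions on `U`. -/
def IsSmoothMultivectorOn {k : ℕ} (U : Set M) (X : MultivectorField E M k) : Prop :=
  ∀ F : Fin k → M → ℝ, (∀ i, SmoothOn E U (F i)) → SmoothOn E U (bracket X F)

/-- Right contraction `ι_α X` with a one-form: `(ι_α X)(β₁,…,β_k) = X(β₁,…,β_k,α)`. -/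
def contract {k : ℕ} (α : (x : M) → Cotangent E x) (X : MultivectorField E M (k + 1)) :
    MultivectorField E M k :=
  fun x => ((X x).domDomCongr (finRotate (k + 1))).curryLeft (α x)

theorem contract_apply {k : ℕ} (α : (x : M) → Cotangent E x)
    (X : MultivectorField E M (k + 1)) (x : M) (β : Fin k → Cotangent E x) :
    contract α X x β = X x (Fin.snoc β (α x)) := by
  rw [Fin.snoc_eq_cons_rotate]
  rfl

/-- Right contraction with the two-form `α ∧ β`: `ι_{α∧β} = ι_α ι_β`. -/
def contractWedge {k : ℕ} (α β : (x : M) → Cotangent E x)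
    (X : MultivectorField E M (k + 2)) : MultivectorField E M k :=
  contract α (contract β X)

/-- `Λ` is a Poisson bivector field on the open set `U`: it is smooth and its bracket satisfies the
Jacobi identity. (Skew-symmetry and the Leibniz rule hold for the bracket of any bivector field.) -/
structure IsPoissonOn (U : Set M) (Λ : MultivectorField E M 2) : Prop where
  smooth : IsSmoothMultivectorOn U Λ
  jacobi : ∀ F₁ F₂ F₃ : M → ℝ, SmoothOn E U F₁ → SmoothOn E U F₂ → SmoothOn E U F₃ →
    ∀ x ∈ U,
      bracket Λ ![bracket Λ ![F₁, F₂], F₃] x + bracket Λ ![bracket Λ ![F₂, F₃], F₁] x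
        + bracket Λ ![bracket Λ ![F₃, F₁], F₂] x = 0

/-- `η` is a Nambu–Poisson `3`-vector field on the open set `U`: it is smooth and its bracket
satisfies the fundamental (Filippov, Takhtajan) identity. (Skew-symmetry and the Leibniz rule hold
for the bracket of any `3`-vector field.) -/
structure IsNambuPoissonOn (U : Set M) (η : MultivectorField E M 3) : Prop where
  smooth : IsSmoothMultivectorOn U η
  fundamental : ∀ F₁ F₂ F₃ F₄ F₅ : M → ℝ, SmoothOn E U F₁ → SmoothOn E U F₂ →
    SmoothOn E U F₃ → SmoothOn E U F₄ → SmoothOn E U F₅ → ∀ x ∈ U,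
      bracket η ![bracket η ![F₁, F₂, F₃], F₄, F₅] x
        + bracket η ![F₃, bracket η ![F₁, F₂, F₄], F₅] x
        + bracket η ![F₃, F₄, bracket η ![F₁, F₂, F₅]] x
      = bracket η ![F₁, F₂, bracket η ![F₃, F₄, F₅]] x

end

/-- An open cover `(U_α)` of `M` with smooth conformal functions `σ_α : U_α → ℝ` whose
differentials agree on the overlaps. -/
structure ConformalCover (E : Type v) [NormedAddCommGroup E] [NormedSpace ℝ E]
    (M : Type u) [TopologicalSpace M] [ChartedSpace E M] where
  /-- the index set of the cover -/
  index : Type u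
  U : index → Set M
  σ : index → M → ℝ
  isOpen_U : ∀ a, IsOpen (U a)
  cover : ∀ x : M, ∃ a, x ∈ U a
  smooth_σ : ∀ a, SmoothOn E (U a) (σ a)
  overlap_σ : ∀ a b, ∀ x ∈ U a ∩ U b,
    (differential (σ a) x : Cotangent E x) = differential (σ b) x

/-- A locally conformally Poisson manifold `(M, U_α, Λ_α, σ_α)`: local Poisson bivector fields with
`e^{-σ_α} Λ_α = e^{-σ_β} Λ_β` on the overlaps. -/
structure LCPoisson (E : Type v) [NormedAddCommGroup E] [NormedSpace ℝ E]
    (M : Type u) [TopologicalSpace M] [ChartedSpace E M] extends ConformalCover E M where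
  Λloc : index → MultivectorField E M 2
  poisson : ∀ a, IsPoissonOn (U a) (Λloc a)
  overlap_Λ : ∀ a b, ∀ x ∈ U a ∩ U b,
    Real.exp (-σ a x) • Λloc a x = Real.exp (-σ b x) • Λloc b x

/-- A locally conformally `3`-Nambu–Poisson manifold `(M, U_α, η_α, σ_α)`: local Nambu–Poisson
`3`-vector fields with `e^{-2σ_α} η_α = e^{-2σ_β} η_β` on the overlaps. -/
structure LCNambuPoisson (E : Type v) [NormedAddCommGroup E] [NormedSpace ℝ E]
    (M : Type u) [TopologicalSpace M] [ChartedSpace E M] extends ConformalCover E M where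
  ηloc : index → MultivectorField E M 3
  nambu : ∀ a, IsNambuPoissonOn (U a) (ηloc a)
  overlap_η : ∀ a b, ∀ x ∈ U a ∩ U b,
    Real.exp (-2 * σ a x) • ηloc a x = Real.exp (-2 * σ b x) • ηloc b x

section

variable {M : Type u} [TopologicalSpace M] [ChartedSpace E M]

/-- `θ` is the Lee form of the conformal cover: `θ = dσ_α` on `U_α`. -/
def ConformalCover.HasLeeForm (C : ConformalCover E M) (θ : (x : M) → Cotangent E x) : Prop :=
  ∀ a, ∀ x ∈ C.U a, θ x = differential (C.σ a) x

/-- The global pair `(Λ, Z)` is a locally conformal Poisson structure with Lee form `θ`: it is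
obtained from a locally conformally Poisson manifold with Lee form `θ` by `Λ = e^{-σ_α} Λ_α` on
`U_α` and `Z = ι_θ Λ`. -/
def IsLCPoisson (Λ : MultivectorField E M 2) (Z : MultivectorField E M 1)
    (θ : (x : M) → Cotangent E x) : Prop :=
  ∃ S : LCPoisson E M, S.HasLeeForm θ ∧
    (∀ a, ∀ x ∈ S.U a, Λ x = Real.exp (-S.σ a x) • S.Λloc a x) ∧
    Z = contract θ Λ

/-- The global pair `(η, 𝓔)` is a locally conformal `3`-Nambu–Poisson structure with Lee form `θ`:
it is obtained from a locally conformally `3`-Nambu–Poisson manifold with Lee form `θ` by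
`η = e^{-2σ_α} η_α` on `U_α` and `𝓔 = -ι_θ η`. -/
def IsLCNambuPoisson (η : MultivectorField E M 3) (𝓔 : MultivectorField E M 2)
    (θ : (x : M) → Cotangent E x) : Prop :=
  ∃ S : LCNambuPoisson E M, S.HasLeeForm θ ∧
    (∀ a, ∀ x ∈ S.U a, η x = Real.exp (-2 * S.σ a x) • S.ηloc a x) ∧
    𝓔 = -contract θ η

end

end LocallyConformal

end

/-!
Locally `θ = dσ` and `d_θ F = e^σ d(e^{-σ} F)`, so with `η' = e^{2σ} η` the bivector field
`ι_{d_θ F} η` equals `e^{-σ} ι_{dG} η'`, where `G = e^{-σ} F` is an arbitrary function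
(`ldrDifferential_eq_exp_smul`). The theorem therefore says that `η'` is Nambu–Poisson if and only
if `ι_{dG} η'` is Poisson for every `G`. That a Nambu–Poisson bracket with one argument fixed is
Poisson is the special case of the fundamental identity in which `G` occurs twice
(`IsNambuPoissonOn.isPoissonOn_contract`).

The converse is a pointwise statement about an alternating triderivation `B` of a commutative
algebra and a character `χ` at which all brackets `B(·, ·, g)` satisfy the Jacobi identity
(`JacobiAt.fundamental`). Given five elements, let `v_{de}` be the iterated bracket
`{{a, b, c}, d, e}` at `χ`, with the sign that makes it depend only on the pair `{d, e}`. The Jacobi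
identity, polarized in `g`, says that the sum `w_e` of the four `v_{xe}` is the same for all five
`e` (`JacobiAt.outerSumAt_swap₄`), and the fundamental identity is a combination of the `w_e`.
So it remains to see that `w_e = 0`. The Leibniz defect of the polarized Jacobi identity is
`ω_u ∧ ω_v = 0` for the bivectors `ω_u = B(u, ·, ·)` at `χ` (`JacobiAt.wedge_eq_zero`); hence the
trivector of `B` at `χ` is decomposable and its kernel has codimension at most three
(`JacobiAt.mem_kernel`). Since `w` is alternating in five arguments and vanishes when one of them is
in the kernel, it vanishes (`JacobiAt.outerSumAt_eq_zero`).

To apply this at a point `x`, germs of smooth functions are extended to global smooth functions by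
bump functions. The hypothesis supplies Jacobi identities for bivector fields that agree near `x`
with `f ι_{dG} η'` where `f = e^{σ' - σ}` for two primitives `σ, σ'` of `θ`; since `df = 0` at `x`,
the factor is harmless (`bracket_bracket_smul`).
-/

section Algebra

/-! ### Alternating triderivations and the fundamental identity -/

/-- An alternating `k`-trilinear bracket on a commutative `k`-algebra that is a derivation in each
argument. By skew-symmetry, linearity and the Leibniz rule are required in the first argument
only. -/
structure IsAlternatingTriderivation (k : Type*) {A : Type*} [Field k] [CommRing A] [Algebra k A]
    (B : A → A → A → A) : Prop where
  swap_left : ∀ a b c, B b a c = -B a b c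
  swap_right : ∀ a b c, B a c b = -B a b c
  add_left : ∀ a a' b c, B (a + a') b c = B a b c + B a' b c
  smul_left : ∀ (r : k) a b c, B (r • a) b c = r • B a b c
  mul_left : ∀ a a' b c, B (a * a') b c = a * B a' b c + a' * B a b c

variable {k A : Type*} [Field k] [CommRing A] [Algebra k A] {B : A → A → A → A}

namespace IsAlternatingTriderivation

theorem rotate (hB : IsAlternatingTriderivation k B) (a b c : A) : B a b c = B c a b := by
  rw [hB.swap_left a c, hB.swap_right a b c, neg_neg]

theorem add_right (hB : IsAlternatingTriderivation k B) (a b c c' : A) :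
    B a b (c + c') = B a b c + B a b c' := by
  rw [hB.rotate, hB.add_left, hB.rotate a b c, hB.rotate a b c']

theorem smul_right (hB : IsAlternatingTriderivation k B) (r : k) (a b c : A) :
    B a b (r • c) = r • B a b c := by
  rw [hB.rotate, hB.smul_left, hB.rotate a b c]

theorem mul_right (hB : IsAlternatingTriderivation k B) (a b c c' : A) :
    B a b (c * c') = c * B a b c' + c' * B a b c := by
  rw [hB.rotate, hB.mul_left, hB.rotate a b c, hB.rotate a b c']

theorem neg_left (hB : IsAlternatingTriderivation k B) (a b c : A) : B (-a) b c = -B a b c := by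
  simpa using hB.smul_left (-1) a b c

end IsAlternatingTriderivation

/-- The iterated bracket `{{a, b, c}, d, e}` evaluated at the point `χ`. -/
def iteratedBracketAt (B : A → A → A → A) (χ : A →ₐ[k] k) (a b c d e : A) : k :=
  χ (B (B a b c) d e)

/-- Fixing any `g` as last argument of `B` gives a bracket that satisfies the Jacobi identity at the
point `χ`. -/
def JacobiAt (B : A → A → A → A) (χ : A →ₐ[k] k) : Prop :=
  ∀ a b c g, χ (B (B a b g) c g) + χ (B (B b c g) a g) + χ (B (B c a g) b g) = 0

/-- The signed sum of the four iterated brackets at `χ` in which `e` is one of the two outer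
arguments. -/
def outerSumAt (B : A → A → A → A) (χ : A →ₐ[k] k) (a b c d e : A) : k :=
  iteratedBracketAt B χ a b c d e - iteratedBracketAt B χ a b d c e
    + iteratedBracketAt B χ a c d b e - iteratedBracketAt B χ b c d a e

variable {χ : A →ₐ[k] k}

section Iterated

theorem iteratedBracketAt_swap₁ (hB : IsAlternatingTriderivation k B) (a b c d e : A) :
    iteratedBracketAt B χ b a c d e = -iteratedBracketAt B χ a b c d e := by
  simp [iteratedBracketAt, hB.swap_left a b, hB.neg_left]

theorem iteratedBracketAt_swap₂ (hB : IsAlternatingTriderivation k B) (a b c d e : A) :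
    iteratedBracketAt B χ a c b d e = -iteratedBracketAt B χ a b c d e := by
  simp [iteratedBracketAt, hB.swap_right a b, hB.neg_left]

theorem iteratedBracketAt_swap_outer (hB : IsAlternatingTriderivation k B) (a b c d e : A) :
    iteratedBracketAt B χ a b c e d = -iteratedBracketAt B χ a b c d e := by
  simp [iteratedBracketAt, hB.swap_right _ d e]

theorem iteratedBracketAt_add_right (hB : IsAlternatingTriderivation k B) (a b c d e e' : A) :
    iteratedBracketAt B χ a b c d (e + e')
      = iteratedBracketAt B χ a b c d e + iteratedBracketAt B χ a b c d e' := by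
  simp [iteratedBracketAt, hB.add_right]

theorem iteratedBracketAt_smul_right (hB : IsAlternatingTriderivation k B) (r : k)
    (a b c d e : A) :
    iteratedBracketAt B χ a b c d (r • e) = r * iteratedBracketAt B χ a b c d e := by
  simp [iteratedBracketAt, hB.smul_right]

theorem iteratedBracketAt_add_inner (hB : IsAlternatingTriderivation k B) (a b c c' d e : A) :
    iteratedBracketAt B χ a b (c + c') d e
      = iteratedBracketAt B χ a b c d e + iteratedBracketAt B χ a b c' d e := by
  simp [iteratedBracketAt, hB.add_right, hB.add_left]

theorem iteratedBracketAt_mul_right (hB : IsAlternatingTriderivation k B) (a b c d e e' : A) :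
    iteratedBracketAt B χ a b c d (e * e')
      = χ e * iteratedBracketAt B χ a b c d e' + χ e' * iteratedBracketAt B χ a b c d e := by
  simp [iteratedBracketAt, hB.mul_right]

theorem iteratedBracketAt_mul_inner (hB : IsAlternatingTriderivation k B) (a b c c' d e : A) :
    iteratedBracketAt B χ a b (c * c') d e
      = χ c * iteratedBracketAt B χ a b c' d e + χ c' * iteratedBracketAt B χ a b c d e
        + χ (B a b c') * χ (B c d e) + χ (B a b c) * χ (B c' d e) := by
  simp [iteratedBracketAt, hB.mul_right, hB.add_left, hB.mul_left]
  ring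

end Iterated

/-- Polarization of the Jacobi identity in the fixed argument. -/
theorem JacobiAt.polarized (hB : IsAlternatingTriderivation k B) (hJ : JacobiAt B χ)
    (a b c g h : A) :
    iteratedBracketAt B χ a b g c h + iteratedBracketAt B χ b c g a h
      + iteratedBracketAt B χ c a g b h + iteratedBracketAt B χ a b h c g
      + iteratedBracketAt B χ b c h a g + iteratedBracketAt B χ c a h b g = 0 := by
  have hJ' : ∀ a b c g, iteratedBracketAt B χ a b g c g + iteratedBracketAt B χ b c g a g
      + iteratedBracketAt B χ c a g b g = 0 := hJ
  have h₁ := hJ' a b c (g + h)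
  simp only [iteratedBracketAt_add_right hB, iteratedBracketAt_add_inner hB] at h₁
  linear_combination h₁ - hJ' a b c g - hJ' a b c h

/-- If all brackets with one argument fixed satisfy the Jacobi identity at `χ`, then the bivectors
`ω_u = B(u, ·, ·)` at `χ` satisfy `ω_u ∧ ω_v = 0`. This is the defect of the Leibniz rule of the
polarized Jacobi identity in its fixed argument. -/
theorem JacobiAt.wedge_eq_zero (hB : IsAlternatingTriderivation k B) (hJ : JacobiAt B χ)
    (u v a b c d : A) :
    χ (B u a b) * χ (B v c d) + χ (B u b c) * χ (B v a d) + χ (B u c a) * χ (B v b d)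
      + χ (B v a b) * χ (B u c d) + χ (B v b c) * χ (B u a d) + χ (B v c a) * χ (B u b d)
      = 0 := by
  have h := hJ.polarized hB a b c d (u * v)
  simp only [iteratedBracketAt_mul_right hB, iteratedBracketAt_mul_inner hB] at h
  have r : ∀ w x y, χ (B x y w) = χ (B w x y) := fun w x y => by rw [hB.rotate]
  simp only [r u, r v] at h
  have hu := hJ.polarized hB a b c d u
  have hv := hJ.polarized hB a b c d v
  linear_combination h - χ u * hv - χ v * hu

/-- If `B` does not vanish at `χ`, say `B(p, q, r) ≠ 0`, then every `s` annihilated by the three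
functionals `B(·, q, r)`, `B(p, ·, r)` and `B(p, q, ·)` at `χ` lies in the kernel of `B` at `χ`:
this is how `ω_u ∧ ω_v = 0` forces a `3`-vector to be decomposable. -/
theorem JacobiAt.mem_kernel [CharZero k] (hB : IsAlternatingTriderivation k B)
    (hJ : JacobiAt B χ) {p q r s : A} (h₀ : χ (B p q r) ≠ 0) (h₁ : χ (B s q r) = 0)
    (h₂ : χ (B p s r) = 0) (h₃ : χ (B p q s) = 0) (t u : A) : χ (B t u s) = 0 := by
  have sl : ∀ x y z, χ (B y x z) = -χ (B x y z) := fun x y z => by rw [hB.swap_left, map_neg]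
  have sr : ∀ x y z, χ (B x z y) = -χ (B x y z) := fun x y z => by rw [hB.swap_right, map_neg]
  have cancel : ∀ x, χ (B p q r) * x = 0 → x = 0 := fun x hx =>
    (mul_eq_zero.1 hx).resolve_left h₀
  -- `ω_q ∧ ω_q` at `(p, r, s, t)` reduces to `B(p, q, r) B(s, q, t)`; likewise with `r` for `q`.
  have hq : ∀ t, χ (B s q t) = 0 := fun t => cancel _ <| by
    linear_combination (1 / 2) * hJ.wedge_eq_zero hB q q p r s t
      + χ (B p q r) * sl q s t - sl p q r * χ (B q s t) - sr q s r * χ (B q p t)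
      + sl s q r * χ (B q p t) - h₁ * χ (B q p t)
      - sr q p s * χ (B q r t) + sl p q s * χ (B q r t) - h₃ * χ (B q r t)
  have hr : ∀ t, χ (B s r t) = 0 := fun t => cancel _ <| by
    have e₁ : χ (B r p q) = χ (B p q r) := by rw [← hB.rotate]
    have e₂ : χ (B r q s) = 0 := by rw [hB.rotate, sr, h₁, neg_zero]
    have e₃ : χ (B r s p) = 0 := by rw [hB.rotate, sr, h₂, neg_zero]
    linear_combination -(1 / 2) * hJ.wedge_eq_zero hB r r p q s t + χ (B p q r) * sl r s t
      + e₁ * χ (B r s t) + e₂ * χ (B r p t) + e₃ * χ (B r q t)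
  -- `ω_p ∧ ω_s` at `(q, r, t, u)` now reduces to `B(p, q, r) B(s, t, u)`.
  have h := hJ.wedge_eq_zero hB p s q r t u
  rw [sr s q t, hq, hq, hq, hr, hr] at h
  rw [hB.rotate]
  exact cancel _ (by linear_combination h)

section OuterSum

theorem outerSumAt_swap₂ (hB : IsAlternatingTriderivation k B) (a b c d e : A) :
    outerSumAt B χ a c b d e = -outerSumAt B χ a b c d e := by
  simp only [outerSumAt]
  linear_combination iteratedBracketAt_swap₂ (χ := χ) hB a b c d e
    - iteratedBracketAt_swap₁ (χ := χ) hB b c d a e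

theorem outerSumAt_swap₃ (hB : IsAlternatingTriderivation k B) (a b c d e : A) :
    outerSumAt B χ a b d c e = -outerSumAt B χ a b c d e := by
  simp only [outerSumAt]
  linear_combination iteratedBracketAt_swap₂ (χ := χ) hB a c d b e
    - iteratedBracketAt_swap₂ (χ := χ) hB b c d a e

/-- The four-term sums at `e` and at `d` agree up to sign: this is exactly the polarized Jacobi
identity. -/
theorem JacobiAt.outerSumAt_swap₄ (hB : IsAlternatingTriderivation k B) (hJ : JacobiAt B χ)
    (a b c d e : A) : outerSumAt B χ a b c e d = -outerSumAt B χ a b c d e := by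
  simp only [outerSumAt]
  linear_combination iteratedBracketAt_swap_outer (χ := χ) hB a b c d e
    - hJ.polarized hB a b c d e + iteratedBracketAt_swap₁ (χ := χ) hB a c d b e
    + iteratedBracketAt_swap₁ (χ := χ) hB a c e b d

theorem outerSumAt_add (hB : IsAlternatingTriderivation k B) (a b c d e e' : A) :
    outerSumAt B χ a b c d (e + e') = outerSumAt B χ a b c d e + outerSumAt B χ a b c d e' := by
  simp only [outerSumAt, iteratedBracketAt_add_right hB]
  ring

theorem outerSumAt_smul (hB : IsAlternatingTriderivation k B) (r : k) (a b c d e : A) :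
    outerSumAt B χ a b c d (r • e) = r * outerSumAt B χ a b c d e := by
  simp only [outerSumAt, iteratedBracketAt_smul_right hB]
  ring

theorem outerSumAt_eq_zero_of_kernel {a b c d e : A} (he : ∀ t u, χ (B t u e) = 0) :
    outerSumAt B χ a b c d e = 0 := by
  simp [outerSumAt, iteratedBracketAt, he]

theorem JacobiAt.outerSumAt_eq_zero_of_combination [CharZero k]
    (hB : IsAlternatingTriderivation k B) (hJ : JacobiAt B χ) {a b c d e : A} {β γ δ ε : k}
    (hε : ε ≠ 0) (hker : ∀ t u, χ (B t u (β • b + γ • c + δ • d + ε • e)) = 0) :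
    outerSumAt B χ a b c d e = 0 := by
  have h := outerSumAt_eq_zero_of_kernel (a := a) (b := b) (c := c) (d := d) hker
  simp only [outerSumAt_add hB, outerSumAt_smul hB] at h
  have hd : ∀ a b c d, outerSumAt B χ a b c d d = 0 := fun a b c d => by
    linear_combination (1 / 2) * hJ.outerSumAt_swap₄ hB a b c d d
  have hc : outerSumAt B χ a b c d c = 0 := by rw [outerSumAt_swap₃ hB, hd, neg_zero]
  have hb : outerSumAt B χ a b c d b = 0 := by
    rw [outerSumAt_swap₂ hB, outerSumAt_swap₃ hB, hd, neg_zero, neg_zero]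
  rw [hd, hc, hb] at h
  simpa [hε] using h

/-- The four-term sums vanish: they are alternating in five arguments and vanish if one argument is
in the kernel of `B` at `χ`, which has codimension at most three. -/
theorem JacobiAt.outerSumAt_eq_zero [CharZero k] (hB : IsAlternatingTriderivation k B)
    (hJ : JacobiAt B χ) (a b c d e : A) : outerSumAt B χ a b c d e = 0 := by
  by_cases h₀ : ∀ p q r, χ (B p q r) = 0
  · exact outerSumAt_eq_zero_of_kernel fun t u => h₀ t u e
  push Not at h₀
  obtain ⟨p, q, r, h₀⟩ := h₀
  -- The kernel of `B` at `χ` is the kernel of `φ`, and four vectors of `k³` are linearly dependent,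
  -- so a nontrivial combination of `b, c, d, e` lies in the kernel.
  let φ : A → Fin 3 → k := fun s => ![χ (B q r s), χ (B p r s), χ (B p q s)]
  have hdep : ¬ LinearIndependent k ![φ b, φ c, φ d, φ e] := fun h => by
    simpa using h.fintype_card_le_finrank
  obtain ⟨g, hg, i, hi⟩ := Fintype.not_linearIndependent_iff.1 hdep
  have hker : ∀ t u, χ (B t u (g 0 • b + g 1 • c + g 2 • d + g 3 • e)) = 0 := by
    have h := fun j => congrFun hg j
    simp only [Fin.sum_univ_four] at h
    refine hJ.mem_kernel hB h₀ ?_ ?_ ?_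
    · rw [← hB.rotate]
      simpa [φ, hB.add_right, hB.smul_right] using h 0
    · rw [hB.swap_right, map_neg, neg_eq_zero]
      simpa [φ, hB.add_right, hB.smul_right] using h 1
    · simpa [φ, hB.add_right, hB.smul_right] using h 2
  -- Permute the argument with nonzero coefficient to the last position.
  fin_cases i
  · have := hJ.outerSumAt_eq_zero_of_combination hB (a := a) (b := e) (c := c) (d := d) (e := b)
      (β := g 3) (γ := g 1) (δ := g 2) (ε := g 0) hi (by convert hker using 5; abel)
    rwa [hJ.outerSumAt_swap₄ hB, outerSumAt_swap₃ hB, outerSumAt_swap₂ hB, outerSumAt_swap₃ hB,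
      hJ.outerSumAt_swap₄ hB, neg_neg, neg_neg, neg_eq_zero] at this
  · have := hJ.outerSumAt_eq_zero_of_combination hB (a := a) (b := b) (c := e) (d := d) (e := c)
      (β := g 0) (γ := g 3) (δ := g 2) (ε := g 1) hi (by convert hker using 5; abel)
    rwa [hJ.outerSumAt_swap₄ hB, outerSumAt_swap₃ hB, hJ.outerSumAt_swap₄ hB, neg_neg,
      neg_eq_zero] at this
  · have := hJ.outerSumAt_eq_zero_of_combination hB (a := a) (b := b) (c := c) (d := e) (e := d)
      (β := g 0) (γ := g 1) (δ := g 3) (ε := g 2) hi (by convert hker using 5; abel)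
    rwa [hJ.outerSumAt_swap₄ hB, neg_eq_zero] at this
  · exact hJ.outerSumAt_eq_zero_of_combination hB hi hker

end OuterSum

/-- If all brackets obtained from `B` by fixing one argument satisfy the Jacobi identity at `χ`,
then `B` satisfies the fundamental identity at `χ`. -/
theorem JacobiAt.fundamental [CharZero k] (hB : IsAlternatingTriderivation k B)
    (hJ : JacobiAt B χ) (a b c d e : A) :
    χ (B (B a b c) d e) + χ (B c (B a b d) e) + χ (B c d (B a b e)) = χ (B a b (B c d e)) := by
  -- The fundamental identity is half of `w_a + w_b - w_c - w_d - w_e`, up to signs, where `w_x` is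
  -- the signed sum of the four iterated brackets with `x` as an outer argument.
  have w := hJ.outerSumAt_eq_zero hB
  have h₁ := w b c d e a
  have h₂ := w a c d e b
  have h₃ := w a b d e c
  have h₄ := w a b c e d
  have h₅ := w a b c d e
  have r₁ : B c (B a b d) e = -B (B a b d) c e := hB.swap_left _ _ _
  have r₂ : B c d (B a b e) = B (B a b e) c d := hB.rotate _ _ _
  have r₃ : B a b (B c d e) = B (B c d e) a b := hB.rotate _ _ _
  rw [r₁, r₂, r₃, map_neg]
  simp only [outerSumAt] at h₁ h₂ h₃ h₄ h₅
  have o := iteratedBracketAt_swap_outer (χ := χ) hB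
  change iteratedBracketAt B χ a b c d e + -iteratedBracketAt B χ a b d c e
    + iteratedBracketAt B χ a b e c d = iteratedBracketAt B χ c d e a b
  -- Bring the two outer arguments into alphabetical order.
  simp only [o a b c d e, o a b d c e, o a b e c d, o a c d b e, o a c e b d, o a d e b c,
    o b c d a e, o b c e a d, o b d e a c, o c d e a b] at h₁ h₂ h₃ h₄ h₅
  grind

end Algebra

namespace LocallyConformal

universe u v

variable {E : Type v} [NormedAddCommGroup E] [NormedSpace ℝ E]
  {M : Type u} [TopologicalSpace M] [ChartedSpace E M]

/-! ### Differentials, brackets and germs -/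

theorem differential_congr {f g : M → ℝ} {x : M} (h : f =ᶠ[𝓝 x] g) :
    (differential f x : Cotangent E x) = differential g x := by
  ext v
  exact congrArg (fun L : TangentSpace 𝓘(ℝ, E) x →L[ℝ] ℝ => L v)
    (h.mfderiv_eq (I := 𝓘(ℝ, E)) (I' := 𝓘(ℝ, ℝ)))

theorem differential_add {f g : M → ℝ} {x : M} (hf : MDifferentiableAt 𝓘(ℝ, E) 𝓘(ℝ, ℝ) f x)
    (hg : MDifferentiableAt 𝓘(ℝ, E) 𝓘(ℝ, ℝ) g x) :
    (differential (f + g) x : Cotangent E x) = differential f x + differential g x :=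
  mvfderiv_add hf hg

theorem differential_sub {f g : M → ℝ} {x : M} (hf : MDifferentiableAt 𝓘(ℝ, E) 𝓘(ℝ, ℝ) f x)
    (hg : MDifferentiableAt 𝓘(ℝ, E) 𝓘(ℝ, ℝ) g x) :
    (differential (f - g) x : Cotangent E x) = differential f x - differential g x :=
  mvfderiv_sub hf hg

theorem differential_mul {f g : M → ℝ} {x : M} (hf : MDifferentiableAt 𝓘(ℝ, E) 𝓘(ℝ, ℝ) f x)
    (hg : MDifferentiableAt 𝓘(ℝ, E) 𝓘(ℝ, ℝ) g x) :
    (differential (f * g) x : Cotangent E x) = f x • differential g x + g x • differential f x := by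
  have := mvfderiv_mul hf hg
  exact this

theorem differential_const_smul (r : ℝ) {f : M → ℝ} {x : M}
    (hf : MDifferentiableAt 𝓘(ℝ, E) 𝓘(ℝ, ℝ) f x) :
    (differential (r • f) x : Cotangent E x) = r • differential f x := by
  have h := differential_mul (mdifferentiableAt_const (c := r) (I := 𝓘(ℝ, E)) (x := x)) hf
  have hc : (differential (fun _ : M => r) x : Cotangent E x) = 0 := mvfderiv_const r
  rw [hc, smul_zero, add_zero] at h
  exact h

theorem differential_exp {f : M → ℝ} {x : M} (hf : MDifferentiableAt 𝓘(ℝ, E) 𝓘(ℝ, ℝ) f x) :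
    (differential (fun y => Real.exp (f y)) x : Cotangent E x)
      = Real.exp (f x) • differential f x := by
  have hexp : MDifferentiableAt 𝓘(ℝ, ℝ) 𝓘(ℝ, ℝ) Real.exp (f x) :=
    Real.differentiableAt_exp.mdifferentiableAt
  ext v
  have h := congrArg (fun L : TangentSpace 𝓘(ℝ, E) x →L[ℝ] ℝ => L v)
    (mfderiv_comp (I := 𝓘(ℝ, E)) (I' := 𝓘(ℝ, ℝ)) (I'' := 𝓘(ℝ, ℝ)) x hexp hf)
  have hd : ∀ t : ℝ, (mfderiv 𝓘(ℝ, ℝ) 𝓘(ℝ, ℝ) Real.exp (f x) : ℝ →L[ℝ] ℝ) t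
      = Real.exp (f x) * t := fun t => by
    rw [mfderiv_eq_fderiv]
    change fderiv ℝ Real.exp (f x) t = _
    rw [fderiv_eq_smul_deriv, Real.deriv_exp, smul_eq_mul, mul_comm]
  exact h.trans (hd _)

theorem mdifferentiableAt_exp {f : M → ℝ} {x : M}
    (hf : MDifferentiableAt 𝓘(ℝ, E) 𝓘(ℝ, ℝ) f x) :
    MDifferentiableAt 𝓘(ℝ, E) 𝓘(ℝ, ℝ) (fun y => Real.exp (f y)) x :=
  MDifferentiableAt.comp (I' := 𝓘(ℝ, ℝ)) (g := Real.exp) x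
    Real.differentiableAt_exp.mdifferentiableAt hf

theorem SmoothOn.mdifferentiableAt {U : Set M} (hU : IsOpen U) {f : M → ℝ} (hf : SmoothOn E U f)
    {x : M} (hx : x ∈ U) : MDifferentiableAt 𝓘(ℝ, E) 𝓘(ℝ, ℝ) f x :=
  (hf.contMDiffAt (hU.mem_nhds hx)).mdifferentiableAt (by simp)

theorem SmoothOn.exp {U : Set M} {f : M → ℝ} (hf : SmoothOn E U f) :
    SmoothOn E U (fun x => Real.exp (f x)) :=
  Real.contDiff_exp.contMDiff.comp_contMDiffOn hf

theorem SmoothOn.mul {U : Set M} {f g : M → ℝ} (hf : SmoothOn E U f) (hg : SmoothOn E U g) :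
    SmoothOn E U (f * g) :=
  ContMDiffOn.mul hf hg

theorem bracket_congr {k : ℕ} {X Y : MultivectorField E M k} {F G : Fin k → M → ℝ} {x : M}
    (hX : ∀ᶠ y in 𝓝 x, X y = Y y) (hF : ∀ i, F i =ᶠ[𝓝 x] G i) :
    bracket X F =ᶠ[𝓝 x] bracket Y G := by
  filter_upwards [hX, Filter.eventually_all.2 fun i => (hF i).eventuallyEq_nhds] with y hy hFy
  simp only [bracket, hy]
  congr 1
  ext1 i
  exact differential_congr (hFy i)

theorem bracket_smul {k : ℕ} (f : M → ℝ) (X : MultivectorField E M k) (F : Fin k → M → ℝ) :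
    bracket (fun x => f x • X x) F = f * bracket X F := by
  ext x
  simp [bracket]

theorem bracket_contract {k : ℕ} (G : M → ℝ) (X : MultivectorField E M (k + 1))
    (F : Fin k → M → ℝ) :
    bracket (contract (fun x => differential G x) X) F = bracket X (Fin.snoc F G) := by
  ext x
  rw [bracket, contract_apply, bracket]
  congr 1
  ext1 i
  refine Fin.lastCases ?_ (fun i => ?_) i <;> simp

theorem bracket_contract_two (G : M → ℝ) (X : MultivectorField E M 3) (f g : M → ℝ) :
    bracket (contract (fun x => differential G x) X) ![f, g] = bracket X ![f, g, G] := by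
  rw [bracket_contract]
  congr 1
  ext1 i
  fin_cases i <;> rfl

theorem IsSmoothMultivectorOn.smul {k : ℕ} {U : Set M} {X : MultivectorField E M k}
    (hX : IsSmoothMultivectorOn U X) {f : M → ℝ} (hf : SmoothOn E U f) :
    IsSmoothMultivectorOn U (fun x => f x • X x) := fun F hF => by
  rw [bracket_smul]
  exact hf.mul (hX F hF)

section Extension

variable [FiniteDimensional ℝ E] [T2Space M] [IsManifold 𝓘(ℝ, E) ∞ M]

/-- Every germ of a smooth function extends to a globally defined smooth function. -/
theorem SmoothOn.exists_eventuallyEq {U : Set M} (hU : IsOpen U) {f : M → ℝ}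
    (hf : SmoothOn E U f) {x : M} (hx : x ∈ U) :
    ∃ g : C^∞⟮𝓘(ℝ, E), M; ℝ⟯, (g : M → ℝ) =ᶠ[𝓝 x] f := by
  obtain ⟨b, -, hb⟩ := (SmoothBumpFunction.nhds_basis_tsupport (I := 𝓘(ℝ, E)) x).mem_iff.1
    (hU.mem_nhds hx)
  refine ⟨⟨fun y => b y • f y, contMDiff_of_tsupport fun y hy => ?_⟩, ?_⟩
  · exact b.contMDiffAt.smul
      (hf.contMDiffAt (hU.mem_nhds (hb (tsupport_smul_subset_left _ _ hy))))
  · filter_upwards [b.eventuallyEq_one] with y hy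
    simp [hy]

theorem IsSmoothMultivectorOn.mono_isOpen {k : ℕ} {X : MultivectorField E M k}
    (hX : IsSmoothMultivectorOn univ X) {U : Set M} (hU : IsOpen U) :
    IsSmoothMultivectorOn U X := fun F hF x hx => by
  choose G hG using fun i => SmoothOn.exists_eventuallyEq hU (hF i) hx
  have h := hX (fun i => G i) (fun i => (G i).contMDiff.contMDiffOn)
  exact ((h.contMDiffAt Filter.univ_mem).congr_of_eventuallyEq
    (bracket_congr (Filter.Eventually.of_forall fun _ => rfl)
      fun i => (hG i).symm)).contMDiffWithinAt

end Extension

/-! ### Symmetries of brackets and contraction with an exact form -/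

theorem bracket_swap_left (X : MultivectorField E M 3) (f g h : M → ℝ) :
    bracket X ![g, f, h] = -bracket X ![f, g, h] := by
  ext x
  rw [Pi.neg_apply, bracket, bracket, ← (X x).map_swap _ (show (0 : Fin 3) ≠ 1 by decide)]
  congr 1
  ext1 i
  fin_cases i <;> rfl

theorem bracket_swap_right (X : MultivectorField E M 3) (f g h : M → ℝ) :
    bracket X ![f, h, g] = -bracket X ![f, g, h] := by
  ext x
  rw [Pi.neg_apply, bracket, bracket, ← (X x).map_swap _ (show (1 : Fin 3) ≠ 2 by decide)]
  congr 1
  ext1 i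
  fin_cases i <;> rfl

theorem bracket_self_right (X : MultivectorField E M 3) (f g : M → ℝ) :
    bracket X ![f, g, g] = 0 :=
  self_eq_neg.1 (bracket_swap_right X f g g)

/-- The bracket as a function that is visibly linear in its first differential. -/
theorem bracket_vecCons {k : ℕ} (X : MultivectorField E M (k + 1)) (f : M → ℝ)
    (F : Fin k → M → ℝ) (x : M) : bracket X (Matrix.vecCons f F) x
      = (X x).curryLeft (differential f x) (fun i => differential (F i) x) := by
  rw [bracket, AlternatingMap.curryLeft_apply_apply]
  congr 1
  ext1 i
  refine Fin.cases ?_ (fun i => ?_) i <;> rfl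

theorem bracket_neg_left {k : ℕ} (X : MultivectorField E M (k + 1)) (f : M → ℝ)
    (F : Fin k → M → ℝ) :
    bracket X (Matrix.vecCons (-f) F) = -bracket X (Matrix.vecCons f F) := by
  ext x
  have h : (differential (-f) x : Cotangent E x) = -differential f x := mvfderiv_neg
  simp [bracket_vecCons, h]

theorem bracket_congr₂ {X Y : MultivectorField E M 2} {f g f' g' : M → ℝ} {x : M}
    (hX : ∀ᶠ y in 𝓝 x, X y = Y y) (hf : f =ᶠ[𝓝 x] f') (hg : g =ᶠ[𝓝 x] g') :
    bracket X ![f, g] =ᶠ[𝓝 x] bracket Y ![f', g'] :=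
  bracket_congr hX (Fin.forall_fin_two.2 ⟨hf, hg⟩)

theorem bracket_congr₃ {X Y : MultivectorField E M 3} {f g h f' g' h' : M → ℝ} {x : M}
    (hX : ∀ᶠ y in 𝓝 x, X y = Y y) (hf : f =ᶠ[𝓝 x] f') (hg : g =ᶠ[𝓝 x] g')
    (hh : h =ᶠ[𝓝 x] h') :
    bracket X ![f, g, h] =ᶠ[𝓝 x] bracket Y ![f', g', h'] :=
  bracket_congr hX fun i => by fin_cases i; exacts [hf, hg, hh]

theorem IsPoissonOn.congr {U : Set M} (hU : IsOpen U) {Λ Λ' : MultivectorField E M 2}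
    (hΛ : IsPoissonOn U Λ) (h : ∀ x ∈ U, Λ' x = Λ x) : IsPoissonOn U Λ' where
  smooth F hF := (hΛ.smooth F hF).congr fun x hx => by rw [bracket, bracket, h x hx]
  jacobi F₁ F₂ F₃ h₁ h₂ h₃ x hx := by
    have he : ∀ᶠ y in 𝓝 x, Λ' y = Λ y := by
      filter_upwards [hU.mem_nhds hx] with y hy using h y hy
    have hb : ∀ f g k : M → ℝ, bracket Λ' ![bracket Λ' ![f, g], k] x
        = bracket Λ ![bracket Λ ![f, g], k] x := fun f g k =>
      (bracket_congr₂ he (bracket_congr₂ he .rfl .rfl) .rfl).eq_of_nhds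
    rw [hb, hb, hb]
    exact hΛ.jacobi F₁ F₂ F₃ h₁ h₂ h₃ x hx

/-- Fixing the last argument of a Nambu–Poisson bracket gives a Poisson bracket. -/
theorem IsNambuPoissonOn.isPoissonOn_contract {U : Set M} {η : MultivectorField E M 3}
    (hη : IsNambuPoissonOn U η) {G : M → ℝ} (hG : SmoothOn E U G) :
    IsPoissonOn U (contract (fun x => differential G x) η) where
  smooth F hF := by
    rw [bracket_contract]
    refine hη.smooth _ fun i => ?_
    refine Fin.lastCases ?_ (fun i => ?_) i
    · rw [Fin.snoc_last]
      exact hG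
    · rw [Fin.snoc_castSucc]
      exact hF i
  jacobi F₁ F₂ F₃ h₁ h₂ h₃ x hx := by
    simp only [bracket_contract_two]
    have h := hη.fundamental F₁ G F₂ F₃ G h₁ hG h₂ h₃ hG x hx
    have hz : bracket η ![F₂, F₃, 0] x = 0 := by
      rw [← bracket_self_right η F₁ G, bracket_swap_right, bracket_swap_left,
        bracket_self_right η F₁ G]
      have := bracket_neg_left η 0 ![F₂, F₃]
      rw [neg_zero] at this
      simp [self_eq_neg.1 this]
    have rot : ∀ f : M → ℝ, bracket η ![F₁, G, f] = bracket η ![f, F₁, G] := fun f => by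
      rw [bracket_swap_right η F₁ f G, bracket_swap_left η f F₁ G, neg_neg]
    rw [bracket_self_right η F₁ G, hz, rot (bracket η ![F₂, F₃, G]), rot F₃,
      bracket_swap_right η F₁ F₂ G, bracket_neg_left, bracket_swap_left η _ F₂ G] at h
    simp only [Pi.neg_apply] at h
    linarith

/-! ### Conformal changes -/

section Conformal

theorem contract_eq_smul {k : ℕ} {α β : (x : M) → Cotangent E x} (X : MultivectorField E M (k + 1))
    {r : ℝ} {x : M} (h : α x = r • β x) : contract α X x = r • contract β X x := by
  simp [contract, h]

theorem contract_smul {k : ℕ} (α : (x : M) → Cotangent E x) (f : M → ℝ)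
    (X : MultivectorField E M (k + 1)) (x : M) :
    contract α (fun y => f y • X y) x = f x • contract α X x := by
  ext β
  simp [contract_apply]

/-- If `θ = dσ` at `x`, then `d_θ F = e^σ d(e^{-σ} F)` at `x`. -/
theorem ldrDifferential_eq_exp_smul {θ : (x : M) → Cotangent E x} {σ F : M → ℝ} {x : M}
    (hσ : MDifferentiableAt 𝓘(ℝ, E) 𝓘(ℝ, ℝ) σ x) (hF : MDifferentiableAt 𝓘(ℝ, E) 𝓘(ℝ, ℝ) F x)
    (hθ : θ x = differential σ x) :
    ldrDifferential θ F x
      = Real.exp (σ x) • differential ((fun y => Real.exp (-σ y)) * F) x := by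
  have hn : (differential (-σ) x : Cotangent E x) = -differential σ x := mvfderiv_neg
  have he : (differential (fun y => Real.exp (-σ y)) x : Cotangent E x)
      = Real.exp (-σ x) • differential (-σ) x := differential_exp hσ.neg
  have hd : MDifferentiableAt 𝓘(ℝ, E) 𝓘(ℝ, ℝ) (fun y => Real.exp (-σ y)) x :=
    mdifferentiableAt_exp hσ.neg
  rw [differential_mul hd hF, he, hn, ldrDifferential, hθ, smul_add, smul_smul, smul_smul,
    smul_smul, mul_right_comm, ← Real.exp_add]
  simp [sub_eq_add_neg]

/-- A conformal factor `f` whose differential vanishes at `x` changes an iterated bracket at `x`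
only by the factor `f(x)²`. -/
theorem bracket_bracket_smul {Λ Λ' : MultivectorField E M 2} {f : M → ℝ} {x : M}
    (h : ∀ᶠ y in 𝓝 x, Λ' y = f y • Λ y) (hf : MDifferentiableAt 𝓘(ℝ, E) 𝓘(ℝ, ℝ) f x)
    (hdf : (differential f x : Cotangent E x) = 0) {a b : M → ℝ} (c : M → ℝ)
    (hab : MDifferentiableAt 𝓘(ℝ, E) 𝓘(ℝ, ℝ) (bracket Λ ![a, b]) x) :
    bracket Λ' ![bracket Λ' ![a, b], c] x
      = f x ^ 2 * bracket Λ ![bracket Λ ![a, b], c] x := by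
  rw [(bracket_congr₂ h ((bracket_congr₂ h .rfl .rfl).trans
    (.of_eq (bracket_smul f Λ ![a, b]))) .rfl).eq_of_nhds, bracket_smul, Pi.mul_apply,
    bracket_vecCons, differential_mul hf hab, hdf, smul_zero, add_zero, map_smul,
    bracket_vecCons, pow_two, mul_assoc]
  rfl

theorem contract_contract_swap {k : ℕ} (α β : (x : M) → Cotangent E x)
    (X : MultivectorField E M (k + 2)) :
    contract α (contract β X) = -contract β (contract α X) := by
  ext x γ
  rw [contract_apply, contract_apply, Pi.neg_apply, AlternatingMap.neg_apply, contract_apply,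
    contract_apply, ← (X x).map_swap _ (Fin.castSucc_lt_last (Fin.last k)).ne]
  congr 1
  ext1 i
  refine Fin.lastCases ?_ (fun i => Fin.lastCases ?_ (fun i => ?_) i) i
  · simp
  · simp
  · rw [Function.comp_apply, Equiv.swap_apply_of_ne_of_ne]
    · simp
    · exact fun h => (Fin.castSucc_lt_last i).ne (Fin.castSucc_injective _ h)
    · exact (Fin.castSucc_lt_last _).ne

end Conformal

/-! ### The two directions of the equivalence -/

/-- On `U_a` the Poisson bivector field is `ι_{dG} η_a` with `G = e^{-σ_a} F`. -/
theorem IsLCNambuPoisson.isLCPoisson_contract {η : MultivectorField E M 3}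
    {θ : (x : M) → Cotangent E x} (h : IsLCNambuPoisson η (-contract θ η) θ)
    (F : C^∞⟮𝓘(ℝ, E), M; ℝ⟯) :
    IsLCPoisson (contract (ldrDifferential θ F) η)
      (-contractWedge (ldrDifferential θ F) θ η) θ := by
  obtain ⟨S, hθ, hS, -⟩ := h
  refine ⟨{ toConformalCover := S.toConformalCover
            Λloc := fun a x => Real.exp (S.σ a x) • contract (ldrDifferential θ F) η x
            poisson := fun a => ?_
            overlap_Λ := fun a b x _ => ?_ }, hθ, fun a x _ => ?_, ?_⟩
  · have hG : SmoothOn E (S.U a) ((fun y => Real.exp (-S.σ a y)) * F) :=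
      (SmoothOn.exp (f := fun y => -S.σ a y) (S.smooth_σ a).neg).mul F.contMDiff.contMDiffOn
    refine ((S.nambu a).isPoissonOn_contract hG).congr (S.isOpen_U a) fun x hx => ?_
    rw [contract_eq_smul η (ldrDifferential_eq_exp_smul
        ((S.smooth_σ a).mdifferentiableAt (S.isOpen_U a) hx)
        (F.contMDiff.mdifferentiable (by simp) x) (hθ a x hx))]
    ext β
    simp only [AlternatingMap.smul_apply, contract_apply, hS a x hx, smul_smul, ← Real.exp_add]
    ring_nf
    simp
  · simp [smul_smul, ← Real.exp_add]
  · simp [smul_smul, ← Real.exp_add]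
  · exact (contract_contract_swap _ _ _).symm

section Global

/-- The bracket of a smooth `3`-vector field as an operation on the algebra of smooth functions. -/
noncomputable def smoothBracket (X : MultivectorField E M 3) (hX : IsSmoothMultivectorOn univ X)
    (f g h : C^∞⟮𝓘(ℝ, E), M; ℝ⟯) : C^∞⟮𝓘(ℝ, E), M; ℝ⟯ :=
  ⟨bracket X ![f, g, h], contMDiffOn_univ.1 <| hX _ fun i => by
    fin_cases i
    exacts [f.contMDiff.contMDiffOn, g.contMDiff.contMDiffOn, h.contMDiff.contMDiffOn]⟩

@[simp]
theorem coe_smoothBracket (X : MultivectorField E M 3) (hX : IsSmoothMultivectorOn univ X)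
    (f g h : C^∞⟮𝓘(ℝ, E), M; ℝ⟯) : ⇑(smoothBracket X hX f g h) = bracket X ![f, g, h] :=
  rfl

/-- Evaluation of smooth functions at a point, as a character of their algebra. -/
noncomputable def evalAt (x : M) : C^∞⟮𝓘(ℝ, E), M; ℝ⟯ →ₐ[ℝ] ℝ where
  toFun f := f x
  map_one' := rfl
  map_mul' _ _ := rfl
  map_zero' := rfl
  map_add' _ _ := rfl
  commutes' _ := rfl

theorem mdifferentiableAt_coe (f : C^∞⟮𝓘(ℝ, E), M; ℝ⟯) (x : M) :
    MDifferentiableAt 𝓘(ℝ, E) 𝓘(ℝ, ℝ) f x :=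
  f.contMDiff.mdifferentiable (by simp) x

theorem isAlternatingTriderivation_smoothBracket {X : MultivectorField E M 3}
    (hX : IsSmoothMultivectorOn univ X) : IsAlternatingTriderivation ℝ (smoothBracket X hX) where
  swap_left f g h := DFunLike.coe_injective (bracket_swap_left X f g h)
  swap_right f g h := DFunLike.coe_injective (bracket_swap_right X f g h)
  add_left f f' g h := by
    ext x
    have := differential_add (mdifferentiableAt_coe f x) (mdifferentiableAt_coe f' x)
    simp [bracket_vecCons, this]
  smul_left r f g h := by
    ext x
    have := differential_const_smul r (mdifferentiableAt_coe f x)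
    simp [bracket_vecCons, this]
  mul_left f f' g h := by
    ext x
    have := differential_mul (mdifferentiableAt_coe f x) (mdifferentiableAt_coe f' x)
    simp [bracket_vecCons, this]

/-- Let `θ = dσ` near `x`. If the pairs attached to `η` and to all functions are locally conformal
Poisson, then all brackets obtained from `e^{2σ} η` by fixing one argument satisfy the Jacobi
identity at `x`. -/
theorem jacobiAt_of_forall_isLCPoisson {η : MultivectorField E M 3}
    {θ : (x : M) → Cotangent E x} {Z : C^∞⟮𝓘(ℝ, E), M; ℝ⟯ → MultivectorField E M 1}
    (h : ∀ F : C^∞⟮𝓘(ℝ, E), M; ℝ⟯, IsLCPoisson (contract (ldrDifferential θ F) η) (Z F) θ)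
    {σ : C^∞⟮𝓘(ℝ, E), M; ℝ⟯} {x : M} (hθ : ∀ᶠ y in 𝓝 x, θ y = differential σ y)
    {X : MultivectorField E M 3} (hX : IsSmoothMultivectorOn univ X)
    (hXη : X = fun y => Real.exp (2 * σ y) • η y) :
    JacobiAt (smoothBracket X hX) (evalAt x) := by
  intro a b c G
  let F : C^∞⟮𝓘(ℝ, E), M; ℝ⟯ :=
    ⟨fun y => Real.exp (σ y) * G y,
      (Real.contDiff_exp.contMDiff.comp σ.contMDiff).mul G.contMDiff⟩
  have hFG : (fun y => Real.exp (-σ y)) * ⇑F = G := by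
    ext y
    simp [F, ← mul_assoc, ← Real.exp_add]
  -- With this choice of `F`, `d_θ F = e^σ dG` near `x`.
  obtain ⟨S, hS, hΛ, -⟩ := h F
  obtain ⟨i, hi⟩ := S.cover x
  have hσ' := (S.smooth_σ i).mdifferentiableAt (S.isOpen_U i) hi
  have hdiff : MDifferentiableAt 𝓘(ℝ, E) 𝓘(ℝ, ℝ) (S.σ i - ⇑σ) x :=
    hσ'.sub (mdifferentiableAt_coe σ x)
  -- `S.σ i` and `σ` are both primitives of `θ`, so `S.σ i - σ` has vanishing differential.
  have hd : (differential (fun y => Real.exp ((S.σ i - ⇑σ) y)) x : Cotangent E x) = 0 := by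
    rw [differential_exp hdiff, differential_sub hσ' (mdifferentiableAt_coe σ x),
      ← hS i x hi, ← hθ.self_of_nhds, sub_self, smul_zero]
  have hloc : ∀ᶠ y in 𝓝 x, S.Λloc i y = Real.exp ((S.σ i - ⇑σ) y) •
      contract (fun z => differential G z) X y := by
    filter_upwards [(S.isOpen_U i).mem_nhds hi, hθ] with y hy hθy
    have h₁ := contract_eq_smul η (ldrDifferential_eq_exp_smul (mdifferentiableAt_coe σ y)
      (mdifferentiableAt_coe F y) hθy)
    rw [hΛ i y hy, hFG] at h₁
    have h₂ := congrArg (fun Λ => Real.exp (S.σ i y) • Λ) h₁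
    simp only [smul_smul, ← Real.exp_add, add_neg_cancel, Real.exp_zero, one_smul] at h₂
    rw [h₂, hXη, contract_smul, smul_smul, ← Real.exp_add, Pi.sub_apply]
    congr 2
    ring
  have key : ∀ f g k : C^∞⟮𝓘(ℝ, E), M; ℝ⟯,
      bracket (S.Λloc i) ![bracket (S.Λloc i) ![f, g], k] x
        = Real.exp ((S.σ i - ⇑σ) x) ^ 2 * bracket X ![bracket X ![f, g, G], k, G] x :=
    fun f g k => by
    have hfg := mdifferentiableAt_coe (smoothBracket X hX f g G) x
    rw [coe_smoothBracket, ← bracket_contract_two] at hfg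
    rw [bracket_bracket_smul hloc (mdifferentiableAt_exp hdiff) hd k hfg,
      bracket_contract_two, bracket_contract_two]
  have hJ := (S.poisson i).jacobi a b c a.contMDiff.contMDiffOn b.contMDiff.contMDiffOn
    c.contMDiff.contMDiffOn x hi
  rw [key, key, key, ← mul_add, ← mul_add] at hJ
  exact (mul_eq_zero.1 hJ).resolve_left (by positivity)

/-- The cover and the functions `σ_a` come from `F = 0`; the local Nambu–Poisson fields are
`e^{2σ_a} η`. Functions on `U_a` are replaced by global ones with the same germ at the given point,
where the algebra of global smooth functions and the evaluation there are available. -/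
theorem isLCNambuPoisson_of_forall_isLCPoisson [FiniteDimensional ℝ E] [T2Space M]
    [IsManifold 𝓘(ℝ, E) ∞ M] {η : MultivectorField E M 3} (hη : IsSmoothMultivectorOn univ η)
    {θ : (x : M) → Cotangent E x} {Z : C^∞⟮𝓘(ℝ, E), M; ℝ⟯ → MultivectorField E M 1}
    (h : ∀ F : C^∞⟮𝓘(ℝ, E), M; ℝ⟯, IsLCPoisson (contract (ldrDifferential θ F) η) (Z F) θ) :
    IsLCNambuPoisson η (-contract θ η) θ := by
  obtain ⟨S, hS, -, -⟩ := h 0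
  refine ⟨{ toConformalCover := S.toConformalCover
            ηloc := fun a x => Real.exp (2 * S.σ a x) • η x
            nambu := fun a => ⟨?_, ?_⟩
            overlap_η := fun a b x _ => ?_ }, hS, fun a x _ => ?_, rfl⟩
  · exact (hη.mono_isOpen (S.isOpen_U a)).smul
      (SmoothOn.exp (f := fun y => 2 * S.σ a y) (contMDiffOn_const.mul (S.smooth_σ a)))
  · intro F₁ F₂ F₃ F₄ F₅ h₁ h₂ h₃ h₄ h₅ x hx
    obtain ⟨σ, hσ⟩ := (S.smooth_σ a).exists_eventuallyEq (S.isOpen_U a) hx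
    obtain ⟨G₁, e₁⟩ := h₁.exists_eventuallyEq (S.isOpen_U a) hx
    obtain ⟨G₂, e₂⟩ := h₂.exists_eventuallyEq (S.isOpen_U a) hx
    obtain ⟨G₃, e₃⟩ := h₃.exists_eventuallyEq (S.isOpen_U a) hx
    obtain ⟨G₄, e₄⟩ := h₄.exists_eventuallyEq (S.isOpen_U a) hx
    obtain ⟨G₅, e₅⟩ := h₅.exists_eventuallyEq (S.isOpen_U a) hx
    have hX : IsSmoothMultivectorOn univ (fun y => Real.exp (2 * σ y) • η y) :=
      hη.smul (SmoothOn.exp (f := fun y => 2 * σ y)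
        (contMDiffOn_const.mul σ.contMDiff.contMDiffOn))
    have hθ : ∀ᶠ y in 𝓝 x, θ y = differential σ y := by
      filter_upwards [hσ.eventuallyEq_nhds, (S.isOpen_U a).mem_nhds hx] with y hy hyU
      rw [hS a y hyU, differential_congr hy]
    have hloc : ∀ᶠ y in 𝓝 x, Real.exp (2 * S.σ a y) • η y = Real.exp (2 * σ y) • η y := by
      filter_upwards [hσ] with y hy
      rw [hy]
    have hJ := (jacobiAt_of_forall_isLCPoisson h hθ hX rfl).fundamental
      (isAlternatingTriderivation_smoothBracket hX) G₁ G₂ G₃ G₄ G₅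
    replace e₁ := e₁.symm
    replace e₂ := e₂.symm
    replace e₃ := e₃.symm
    replace e₄ := e₄.symm
    replace e₅ := e₅.symm
    rw [(bracket_congr₃ hloc (bracket_congr₃ hloc e₁ e₂ e₃) e₄ e₅).eq_of_nhds,
      (bracket_congr₃ hloc e₃ (bracket_congr₃ hloc e₁ e₂ e₄) e₅).eq_of_nhds,
      (bracket_congr₃ hloc e₃ e₄ (bracket_congr₃ hloc e₁ e₂ e₅)).eq_of_nhds,
      (bracket_congr₃ hloc e₁ e₂ (bracket_congr₃ hloc e₃ e₄ e₅)).eq_of_nhds]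
    exact hJ
  · simp [smul_smul, ← Real.exp_add]
  · simp [smul_smul, ← Real.exp_add]

end Global

end LocallyConformal

theorem mainTheorem7 {E : Type*} [NormedAddCommGroup E] [NormedSpace ℝ E] [FiniteDimensional ℝ E]
    {M : Type*} [TopologicalSpace M] [T2Space M] [ChartedSpace E M] [IsManifold 𝓘(ℝ, E) ∞ M]
    (η : LocallyConformal.MultivectorField E M 3)
    (hη : LocallyConformal.IsSmoothMultivectorOn univ η)
    (θ : LocallyConformal.SmoothOneForm E M) :
    LocallyConformal.IsLCNambuPoisson η (-LocallyConformal.contract θ η) θ ↔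
      ∀ F : C^∞⟮𝓘(ℝ, E), M; ℝ⟯,
        LocallyConformal.IsLCPoisson
          (LocallyConformal.contract (LocallyConformal.ldrDifferential θ F) η)
          (-LocallyConformal.contractWedge (LocallyConformal.ldrDifferential θ F) θ η)
          θ :=
  ⟨fun h F => h.isLCPoisson_contract F,
    LocallyConformal.isLCNambuPoisson_of_forall_isLCPoisson hη⟩
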